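/- Let $\Omega$ be a non-empty compact Hausdorff space equipped with its Baire $\sigma$-algebra (the one generated by the continuous real-valued functions), and let $\mathcal{P}(\Omega)$ be the set of all probability measures on $\Omega$ with the weak$^*$ topology (the coarsest topology making $p\mapsto\int_\Omega g\,\mathrm{d}p$ continuous for every continuous $g:\Omega\to\mathbb{R}$). Let $\mathcal{P}_{\mathrm{fin}}(\mathcal{P}(\Omega))$ be the set of all probability measures on $\mathcal{P}(\Omega)$ concentrated on a finite set; for $P$ in it, let $D(P)\subseteq\mathcal{P}(\Omega)$ be the smallest finite set of $P$-probability one. The randomized game is the following perfect-information game, with initial capitals $K_0:=1$ and $F_0:=1$. In each round $n=1,2,\dots$: 1. Sceptic announces a function $S_n:\Omega\times\mathcal{P}(\Omega)\to\mathbb{R}$ which is continuous in the first argument and satisfies $\int_\Omega S_n(\omega,p)\,p(\mathrm{d}\omega)\le 0$ for all $p\in\mathcal{P}(\Omega)$; 2. Forecaster announces $P_n\in\mathcal{P}_{\mathrm{fin}}(\mathcal{P}(\Omega))$; 3. Reality announces $\omega_n\in\Omega$; 4. Forecaster announces a function $f_n:\mathcal{P}(\Omega)\to\mathbb{R}$ with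 $\int f_n\,\mathrm{d}P_n\le 0$; 5. Random Number Generator announces $p_n\in D(P_n)$; 6. $K_n:=K_{n-1}+S_n(\omega_n,p_n)$ and $F_n:=F_{n-1}+f_n(p_n)$. Sceptic must choose $S_n$ so that $K_n\ge 0$ no matter how the other players move (that is, $K_{n-1}+S_n(\omega,p)\ge 0$ for all $\omega\in\Omega$ and $p\in\mathcal{P}(\Omega)$), and Forecaster must choose his moves so that $F_n\ge 0$ no matter how the other players move. Theorem. For any $\epsilon>0$ and any sequence $\mathcal{A}_1,\mathcal{A}_2,\dots$ of open covers of $\mathcal{P}(\Omega)$, Forecaster has a strategy in the randomized game, obeying the above restriction on Forecaster, which guarantees, for every $n$: - $K_n\le(1+\epsilon)F_n$; - $D(P_n)$ lies completely in one element of $\mathcal{A}_n$; - $|D(P_n)|\le|\Omega|$. -/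

import Mathlib

namespace DefensiveForecasting

universe u

/-- The Baire `σ`-algebra of a topological space: the smallest `σ`-algebra for which every
continuous real-valued function is measurable. -/
@[reducible] def baireSigmaAlgebra (Ω : Type u) [TopologicalSpace Ω] : MeasurableSpace Ω :=
  ⨆ g : C(Ω, ℝ), MeasurableSpace.comap (fun ω => g ω) (borel ℝ)

/-- The set of all probability measures on `Ω` equipped with its Baire `σ`-algebra. -/
def Prob (Ω : Type u) [TopologicalSpace Ω] : Type u :=
  @MeasureTheory.ProbabilityMeasure Ω (baireSigmaAlgebra Ω)

/-- The integral of a real-valued function against a Baire probability measure. -/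
noncomputable def Prob.integral {Ω : Type u} [TopologicalSpace Ω] (p : Prob Ω) (g : Ω → ℝ) : ℝ :=
  @MeasureTheory.integral Ω ℝ _ _ (baireSigmaAlgebra Ω) p.1 g

/-- The weak-star topology: the coarsest topology that makes `p ↦ ∫ g dp` continuous for every
continuous function `g` on `Ω`. -/
noncomputable instance Prob.instTopologicalSpace (Ω : Type u) [TopologicalSpace Ω] :
    TopologicalSpace (Prob Ω) :=
  TopologicalSpace.induced (fun (p : Prob Ω) (g : C(Ω, ℝ)) => p.integral (fun ω => g ω))
    inferInstance

/-- Probability measures concentrated on a finite subset of `X`, given by their weights. -/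
abbrev FinProb (X : Type u) : Type u := Convexity.StdSimplex ℝ X

/-- The smallest finite set of probability one: the set of points of positive weight. -/
def FinProb.carrier {X : Type u} (P : FinProb X) : Finset X := P.weights.support

/-- The integral of an arbitrary function against a finitely supported probability measure. -/
noncomputable def FinProb.integral {X : Type u} (P : FinProb X) (f : X → ℝ) : ℝ :=
  ∑ x ∈ P.carrier, P.weights x * f x

/-- A move of Sceptic: a function `S(ω, p)` that is continuous in `ω` and satisfies
`∫ S(ω, p) p(dω) ≤ 0` for every `p`; the dependence on `p` is otherwise arbitrary. -/
structure ScepticMove (Ω : Type u) [TopologicalSpace Ω] where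
  toFun : Ω → Prob Ω → ℝ
  continuous_left : ∀ p : Prob Ω, Continuous (fun ω => toFun ω p)
  integral_nonpos : ∀ p : Prob Ω, p.integral (fun ω => toFun ω p) ≤ 0

/-- All the moves made in one round of the randomized game, in the order in which they are made:
Sceptic's `S`, Forecaster's `P`, Reality's `ω`, Forecaster's `f`, Random Number Generator's `p`. -/
structure Round (Ω : Type u) [TopologicalSpace Ω] where
  S : ScepticMove Ω
  P : FinProb (Prob Ω)
  ω : Ω
  f : Prob Ω → ℝ
  p : Prob Ω

/-- A strategy for Forecaster. Each of his moves may depend on all moves made before it.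
Rounds are counted from zero, so that round `n` has the history `Fin n → Round Ω`. -/
structure ForecasterStrategy (Ω : Type u) [TopologicalSpace Ω] where
  /-- the randomized forecast, announced after Sceptic's move -/
  forecast : (n : ℕ) → (Fin n → Round Ω) → ScepticMove Ω → FinProb (Prob Ω)
  /-- the bet against Random Number Generator, announced after Reality's move -/
  bet : (n : ℕ) → (Fin n → Round Ω) → ScepticMove Ω → FinProb (Prob Ω) → Ω → (Prob Ω → ℝ)

/-- Sceptic's capital after the first `n` rounds of the play `r`. -/
def scepticCapital {Ω : Type u} [TopologicalSpace Ω] (r : ℕ → Round Ω) : ℕ → ℝ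
  | 0 => 1
  | n + 1 => scepticCapital r n + (r n).S.toFun (r n).ω (r n).p

/-- Forecaster's capital after the first `n` rounds of the play `r`. -/
def forecasterCapital {Ω : Type u} [TopologicalSpace Ω] (r : ℕ → Round Ω) : ℕ → ℝ
  | 0 => 1
  | n + 1 => forecasterCapital r n + (r n).f (r n).p

/-- In round `n` of the play `r`, Forecaster makes the moves prescribed by the strategy `σ`. -/
def FollowsAt {Ω : Type u} [TopologicalSpace Ω] (σ : ForecasterStrategy Ω) (r : ℕ → Round Ω)
    (n : ℕ) : Prop :=
  (r n).P = σ.forecast n (fun i => r i) (r n).S ∧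
    (r n).f = σ.bet n (fun i => r i) (r n).S (r n).P (r n).ω

/-- In round `n` of the play `r`, the opponents of Forecaster obey the rules: Sceptic's move keeps
his capital nonnegative no matter how the other players move (any `ω`, and any `p`, may still be
announced when Sceptic moves), and Random Number Generator chooses a point of `D(P)`. -/
def OpponentsLegalAt {Ω : Type u} [TopologicalSpace Ω] (r : ℕ → Round Ω) (n : ℕ) : Prop :=
  (∀ (ω : Ω) (p : Prob Ω), 0 ≤ scepticCapital r n + (r n).S.toFun ω p) ∧
    (r n).p ∈ (r n).P.carrier

/-- Forecaster's moves in round `n` of the play `r` obey the rules: his bet has a nonpositive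
expectation under his randomized forecast, and his capital after the round is nonnegative whichever
point of `D(P)` is announced by Random Number Generator. -/
def ForecasterLegalAt {Ω : Type u} [TopologicalSpace Ω] (r : ℕ → Round Ω) (n : ℕ) : Prop :=
  (r n).P.integral (r n).f ≤ 0 ∧
    ∀ p ∈ (r n).P.carrier, 0 ≤ forecasterCapital r n + (r n).f p

end DefensiveForecasting

/-!
In each round, Forecaster looks for a randomized forecast `P` that leaves Sceptic an expected gain
`∫ S(ω, p) P(dp)` below a small `δ` for every `ω`. Given such forecasts with `δ = ε / 2 ^ (n + 1)` in
round `n`, he bets `(S(ω, p) - ∫ S(ω, ·) dP) / (1 + ε)`, which has expectation zero, and then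
`(1 + ε) F - K` is never less than what remains of the initial reserve `ε`.

The forecast exists because of a minimax argument that needs no regularity of `S` in `p`
(`ScepticMove.exists_mem_convexHull_lt`). If an element `U` of the cover contains the support of no
suitable `P`, then the convex hull of the functions `S(·, p)`, `p ∈ U`, can be separated from the
functions below `δ`, which by Riesz representation yields a probability measure `q U` with
`∫ S(ω, p) q U (dω) ≥ δ` for all `p ∈ U` (`exists_prob_forall_le_integral`). If this happens for all
`U`, take a partition of unity `φ` subordinate to a finite subcover of the compact space of
probability measures. Brouwer's theorem for the simplex spanned by the `q U` gives a
`p = ∑ φ U p • q U`; only the `U` that contain `p` contribute, so `∫ S(ω, p) p(dω) ≥ δ > 0`, which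
Sceptic's move rules out. The bound on the size of the support is Carathéodory's theorem for cones,
applied to the vectors `S(·, p) - δ` (`exists_card_le_sum_neg`).

Brouwer's theorem is derived from Scarf's lemma (`Scarf.exists_isDominating_colorful`), a
combinatorial relative of Sperner's lemma in which a family of linear orders takes the place of a
triangulation.
-/

/-! ### Scarf's lemma -/

namespace Scarf

variable {ι V α : Type*} [LinearOrder α]

/-- A finite set `X` of points is dominating, with respect to the rankings `h i`, if no point is
ranked by every `h i` strictly above the `h i`-lowest element of `X`. -/
def IsDominating (h : ι → V → α) (X : Finset V) : Prop :=
  ∀ v, ∃ i, ∀ x ∈ X, h i v ≤ h i x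

theorem IsDominating.mono {h : ι → V → α} {X Y : Finset V} (hX : IsDominating h X) (hYX : Y ⊆ X) :
    IsDominating h Y := fun v =>
  let ⟨i, hi⟩ := hX v
  ⟨i, fun x hx => hi x (hYX hx)⟩

/-- The points ranked above the lowest element of `Y` by every ranking other than the `k`-th. -/
def above (h : ι → V → α) (m : ι → V) (k : ι) : Set V :=
  {v | ∀ i, i ≠ k → h i (m i) < h i v}

theorem exists_highest [Finite V] {h : ι → V → α} {m : ι → V} (k : ι) (hne : (above h m k).Nonempty) :
    ∃ v ∈ above h m k, ∀ w ∈ above h m k, h k w ≤ h k v :=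
  Set.exists_max_image _ (h k) (Set.toFinite _) hne

variable [Fintype ι] [DecidableEq ι] [DecidableEq V]

/-- A colouring of `|ι|` points has exactly one facet carrying all colours but `i₀` if all colours
occur, and otherwise it has none or two such facets. -/
theorem odd_card_facets_iff (c : V → ι) (i₀ : ι) (X : Finset V) (hX : X.card = Fintype.card ι) :
    Odd (X.filter fun x => (X.erase x).image c = Finset.univ.erase i₀).card ↔
      X.image c = Finset.univ := by
  by_cases hc : X.image c = Finset.univ
  · have hinj : Set.InjOn c X := by
      rw [← Finset.card_image_iff, hc, hX, Finset.card_univ]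
    obtain ⟨x, hx, hxc⟩ := Finset.mem_image.1 (hc ▸ Finset.mem_univ i₀)
    have : (X.filter fun x => (X.erase x).image c = Finset.univ.erase i₀) = {x} := by
      ext z
      simp only [Finset.mem_filter, Finset.mem_singleton]
      constructor
      · rintro ⟨hz, h⟩
        by_contra hzx
        have : i₀ ∈ (X.erase z).image c :=
          Finset.mem_image.2 ⟨x, Finset.mem_erase.2 ⟨fun e => hzx e.symm, hx⟩, hxc⟩
        rw [h] at this
        simp at this
      · rintro rfl
        refine ⟨hx, ?_⟩
        ext j
        simp only [Finset.mem_image, Finset.mem_erase, Finset.mem_univ, and_true]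
        constructor
        · rintro ⟨y, ⟨hyz, hy⟩, rfl⟩ e
          exact hyz (hinj hy hx (e.trans hxc.symm))
        · intro hj
          obtain ⟨y, hy, rfl⟩ := Finset.mem_image.1 (hc ▸ Finset.mem_univ j)
          exact ⟨y, ⟨fun e => hj (e ▸ hxc), hy⟩, rfl⟩
    simp [this, hc]
  · simp only [hc, iff_false, Nat.not_odd_iff_even]
    rcases (X.filter fun x => (X.erase x).image c = Finset.univ.erase i₀).eq_empty_or_nonempty
      with h0 | ⟨x, hx⟩
    · simp [h0]
    obtain ⟨hxX, hxc⟩ := Finset.mem_filter.1 hx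
    have hinj : Set.InjOn c (X.erase x : Finset V) := by
      rw [← Finset.card_image_iff, hxc, Finset.card_erase_of_mem hxX, hX,
        Finset.card_erase_of_mem (Finset.mem_univ _), Finset.card_univ]
    have himg : X.image c = insert (c x) (Finset.univ.erase i₀) := by
      rw [← hxc, ← Finset.image_insert, Finset.insert_erase hxX]
    have hcx : c x ≠ i₀ := by
      intro e
      rw [e, Finset.insert_erase (Finset.mem_univ _)] at himg
      exact hc himg
    obtain ⟨y, hy, hyx⟩ : ∃ y ∈ X.erase x, c y = c x := by
      rw [← Finset.mem_image, hxc]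
      simp [hcx]
    have hyX := Finset.mem_of_mem_erase hy
    have hne : y ≠ x := Finset.ne_of_mem_erase hy
    have : (X.filter fun x => (X.erase x).image c = Finset.univ.erase i₀) = {x, y} := by
      ext z
      simp only [Finset.mem_filter, Finset.mem_singleton, Finset.mem_insert]
      constructor
      · rintro ⟨hz, h⟩
        by_contra! hzn
        have hcz : c z ∈ (X.erase z).image c := by
          have : c z ∈ (X.erase x).image c :=
            Finset.mem_image_of_mem _ (Finset.mem_erase.2 ⟨hzn.1, hz⟩)
          rw [h]; rwa [hxc] at this
        obtain ⟨w, hw, hwz⟩ := Finset.mem_image.1 hcz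
        obtain ⟨hwz', hwX⟩ := Finset.mem_erase.1 hw
        by_cases hwx : w = x
        · subst hwx
          exact hzn.2 (hinj (by simp [hzn.1, hz]) (by simp [hne, hyX]) (hwz.symm.trans hyx.symm))
        · exact hwz' (hinj (by simp [hwx, hwX]) (by simp [hzn.1, hz]) hwz)
      · rintro (rfl | rfl)
        · exact ⟨hxX, hxc⟩
        · refine ⟨hyX, ?_⟩
          rw [← hxc]
          ext j
          simp only [Finset.mem_image, Finset.mem_erase]
          constructor
          · rintro ⟨w, ⟨hw1, hw2⟩, rfl⟩
            by_cases hwx : w = x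
            · exact ⟨z, ⟨hne, hyX⟩, by rw [hyx, hwx]⟩
            · exact ⟨w, ⟨hwx, hw2⟩, rfl⟩
          · rintro ⟨w, ⟨hw1, hw2⟩, rfl⟩
            by_cases hwy : w = z
            · exact ⟨x, ⟨hne.symm, hxX⟩, by rw [hwy, hyx]⟩
            · exact ⟨w, ⟨hwy, hw2⟩, rfl⟩
    rw [this, Finset.card_pair hne.symm]
    decide

section Doors

variable {h : ι → V → α} {Y : Finset V} {m : ι → V} {a b : ι}

/-- If `Y` has one point less than there are rankings and each point of the dominating set `Y` is
lowest in some ranking, then only one pair of rankings shares its lowest point. -/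
theorem eq_of_lowest_eq (hinj : ∀ i, Function.Injective (h i))
    (hm : ∀ i, m i ∈ Y ∧ ∀ y ∈ Y, h i (m i) ≤ h i y) (hY : Y.card + 1 = Fintype.card ι)
    (hdom : IsDominating h Y) (hab : a ≠ b) (hmab : m a = m b) :
    (∀ i j, i ≠ j → m i = m j → (i = a ∨ i = b) ∧ (j = a ∨ j = b)) ∧
    ∀ k, (k = a ∨ k = b) → ∀ y ∈ Y, ∃ i, i ≠ k ∧ m i = y := by
  have hsurj : ∀ y ∈ Y, ∃ i, m i = y := by
    intro y hy
    obtain ⟨i, hi⟩ := hdom y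
    exact ⟨i, hinj i (le_antisymm ((hm i).2 y hy) (hi _ (hm i).1))⟩
  have hsurj' : ∀ k, (k = a ∨ k = b) → ∀ y ∈ Y, ∃ i, i ≠ k ∧ m i = y := by
    intro k hk y hy
    obtain ⟨i, rfl⟩ := hsurj y hy
    by_cases hik : i = k
    · rcases hk with rfl | rfl
      · exact ⟨b, hab.symm, by rw [← hmab, hik]⟩
      · exact ⟨a, hab, by rw [hmab, hik]⟩
    · exact ⟨i, hik, rfl⟩
  have hinjOn : ∀ k, (k = a ∨ k = b) → Set.InjOn m (Finset.univ.erase k : Finset ι) := by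
    intro k hk
    rw [← Finset.card_image_iff, Finset.card_erase_of_mem (Finset.mem_univ _), Finset.card_univ,
      ← hY, Nat.add_sub_cancel]
    congr 1
    ext y
    simp only [Finset.mem_image, Finset.mem_erase, Finset.mem_univ, and_true]
    exact ⟨fun ⟨i, _, e⟩ => e ▸ (hm i).1, fun hy => hsurj' k hk y hy⟩
  refine ⟨fun i j hij e => ?_, hsurj'⟩
  have key : ∀ k, (k = a ∨ k = b) → i = k ∨ j = k := by
    intro k hk
    by_contra! hn
    exact hij (hinjOn k hk (by simp [hn.1]) (by simp [hn.2]) e)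
  rcases key a (.inl rfl) with h1 | h1 <;> rcases key b (.inr rfl) with h2 | h2
  · exact (hab (h1.symm.trans h2)).elim
  · exact ⟨.inl h1, .inr h2⟩
  · exact ⟨.inr h2, .inl h1⟩
  · exact (hab (h1.symm.trans h2)).elim

/-- The points that complete `Y` to a larger dominating set: for each of the two rankings `k` that
share their lowest point in `Y`, the `h k`-highest point of `above h m k`. -/
theorem isDominating_insert_iff (hinj : ∀ i, Function.Injective (h i))
    (hm : ∀ i, m i ∈ Y ∧ ∀ y ∈ Y, h i (m i) ≤ h i y) (hY : Y.card + 1 = Fintype.card ι)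
    (hdom : IsDominating h Y) (hab : a ≠ b) (hmab : m a = m b) (v : V) :
    (v ∉ Y ∧ IsDominating h (insert v Y)) ↔
      ∃ k, (k = a ∨ k = b) ∧ v ∈ above h m k ∧ ∀ w ∈ above h m k, h k w ≤ h k v := by
  obtain ⟨huniq, hsurj⟩ := eq_of_lowest_eq hinj hm hY hdom hab hmab
  constructor
  · rintro ⟨hv, hd⟩
    obtain ⟨k, hk⟩ := hd v
    have hsel : ∀ y ∈ Y, ∃ i, i ≠ k ∧ m i = y ∧ h i y ≤ h i v := by
      intro y hy
      obtain ⟨i, hi⟩ := hd y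
      refine ⟨i, ?_, hinj i (le_antisymm ((hm i).2 y hy) (hi _ (by simp [(hm i).1]))),
        hi v (by simp)⟩
      rintro rfl
      have := hinj i (le_antisymm (hi v (by simp)) (hk y (by simp [hy])))
      exact hv (this ▸ hy)
    have hkab : k = a ∨ k = b := by
      obtain ⟨i, hik, e, -⟩ := hsel (m k) (hm k).1
      exact (huniq i k hik e).2
    have hvM : v ∈ above h m k := by
      intro i hik
      obtain ⟨j, hjk, e, hle⟩ := hsel (m i) (hm i).1
      have hji : j = i := by
        by_contra hne
        have := huniq j i hne e
        grind
      subst hji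
      exact lt_of_le_of_ne hle fun e' => hv (hinj j e' ▸ (hm j).1)
    refine ⟨k, hkab, hvM, fun w hw => ?_⟩
    obtain ⟨i, hi⟩ := hd w
    by_cases hik : i = k
    · subst hik
      exact hi v (by simp)
    · exact absurd (hi (m i) (by simp [(hm i).1])) (not_le.2 (hw i hik))
  · rintro ⟨k, hk, hvM, hmax⟩
    refine ⟨fun hv => ?_, fun w => ?_⟩
    · obtain ⟨i, hik, rfl⟩ := hsurj k hk v hv
      exact lt_irrefl _ (hvM i hik)
    · by_cases hw : w ∈ above h m k
      · refine ⟨k, fun x hx => ?_⟩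
        rcases Finset.mem_insert.1 hx with rfl | hx
        · exact hmax w hw
        · obtain ⟨i, hi⟩ := hdom v
          by_cases hik : i = k
          · subst hik
            exact (hmax w hw).trans (hi x hx)
          · exact absurd (hi (m i) (hm i).1) (not_le.2 (hvM i hik))
      · simp only [above, Set.mem_ofPred_eq, not_forall, not_lt] at hw
        obtain ⟨i, hik, hi⟩ := hw
        refine ⟨i, fun x hx => ?_⟩
        rcases Finset.mem_insert.1 hx with rfl | hx
        · exact hi.trans (hvM i hik).le
        · exact hi.trans ((hm i).2 x hx)

variable [Fintype V]

open Classical in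
/-- An interior facet `Y` of the complex of dominating sets lies in exactly two of them. -/
theorem card_completions_eq_two (hinj : ∀ i, Function.Injective (h i))
    (hm : ∀ i, m i ∈ Y ∧ ∀ y ∈ Y, h i (m i) ≤ h i y) (hY : Y.card + 1 = Fintype.card ι)
    (hdom : IsDominating h Y) (hab : a ≠ b) (hmab : m a = m b)
    (ha : (above h m a).Nonempty) (hb : (above h m b).Nonempty) :
    (Finset.univ.filter fun v => v ∉ Y ∧ IsDominating h (insert v Y)).card = 2 := by
  obtain ⟨v, hv, hv'⟩ := exists_highest a ha
  obtain ⟨w, hw, hw'⟩ := exists_highest b hb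
  have hvw : v ≠ w := by
    rintro rfl
    obtain ⟨i, hi⟩ := hdom v
    have hi' := hi (m i) (hm i).1
    by_cases hia : i = a
    · exact absurd hi' (not_le.2 (hw i (hia ▸ hab)))
    · exact absurd hi' (not_le.2 (hv i hia))
  rw [← Finset.card_pair hvw]
  congr 1
  ext x
  simp only [Finset.mem_filter, Finset.mem_univ, true_and, Finset.mem_insert,
    Finset.mem_singleton, isDominating_insert_iff hinj hm hY hdom hab hmab]
  constructor
  · rintro ⟨k, rfl | rfl, hx, hx'⟩
    · exact .inl (hinj k (le_antisymm (hv' x hx) (hx' v hv)))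
    · exact .inr (hinj k (le_antisymm (hw' x hx) (hx' w hw)))
  · rintro (rfl | rfl)
    · exact ⟨a, .inl rfl, hv, hv'⟩
    · exact ⟨b, .inr rfl, hw, hw'⟩

open Classical in
/-- A boundary facet `Y` of the complex of dominating sets lies in exactly one of them. -/
theorem card_completions_eq_one (hinj : ∀ i, Function.Injective (h i))
    (hm : ∀ i, m i ∈ Y ∧ ∀ y ∈ Y, h i (m i) ≤ h i y) (hY : Y.card + 1 = Fintype.card ι)
    (hdom : IsDominating h Y) (hab : a ≠ b) (hmab : m a = m b)
    (ha : (above h m a).Nonempty) (hb : above h m b = ∅) :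
    (Finset.univ.filter fun v => v ∉ Y ∧ IsDominating h (insert v Y)).card = 1 := by
  obtain ⟨v, hv, hv'⟩ := exists_highest a ha
  rw [Finset.card_eq_one]
  refine ⟨v, ?_⟩
  ext x
  simp only [Finset.mem_filter, Finset.mem_univ, true_and,
    Finset.mem_singleton, isDominating_insert_iff hinj hm hY hdom hab hmab]
  constructor
  · rintro ⟨k, rfl | rfl, hx, hx'⟩
    · exact hinj k (le_antisymm (hv' x hx) (hx' v hv))
    · simp [hb] at hx
  · rintro rfl
    exact ⟨a, .inl rfl, hv, hv'⟩

end Doors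

section Main

variable [Fintype V] [Nontrivial ι] {h : ι → V → α} {s : ι → V} {c : V → ι}

open Classical in
/-- Parity of the number of dominating sets through a facet that carries all colours but `i₀`: the
facet made of the slack points is the only one on the boundary. -/
theorem odd_card_completions_iff (hinj : ∀ i, Function.Injective (h i))
    (hlow : ∀ i v, h i (s i) ≤ h i v)
    (hhigh : ∀ i j v, i ≠ j → v ∉ Set.range s → h i v < h i (s j))
    (hc : ∀ i, c (s i) = i) (hT : ∃ t, t ∉ Set.range s) (i₀ : ι) (Y : Finset V)
    (hY : Y.card + 1 = Fintype.card ι) (hdom : IsDominating h Y)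
    (hYc : Y.image c = Finset.univ.erase i₀) :
    Odd (Finset.univ.filter fun v => v ∉ Y ∧ IsDominating h (insert v Y)).card ↔
      Y = (Finset.univ.erase i₀).image s := by
  have hsinj : Function.Injective s := fun i j e => by rw [← hc i, ← hc j, e]
  have hYne : Y.Nonempty := by
    rw [← Finset.card_pos]
    have := Fintype.one_lt_card (α := ι)
    omega
  choose m hm using fun i => Finset.exists_min_image Y (h i) hYne
  by_cases hY0 : Y = (Finset.univ.erase i₀).image s
  · simp only [hY0, iff_true]
    rw [← hY0]
    have hmj : ∀ j, j ≠ i₀ → m j = s j := by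
      intro j hj
      refine hinj j (le_antisymm ((hm j).2 _ ?_) (hlow j _))
      rw [hY0]
      exact Finset.mem_image_of_mem _ (by simp [hj])
    obtain ⟨b, hb, hmb⟩ := Finset.mem_image.1 (hY0 ▸ (hm i₀).1)
    have hbi : b ≠ i₀ := Finset.ne_of_mem_erase hb
    have hab : m i₀ = m b := by rw [hmj b hbi, hmb]
    rw [card_completions_eq_one hinj hm hY hdom hbi.symm hab]
    · exact odd_one
    · obtain ⟨t, ht⟩ := hT
      refine ⟨t, fun i hi => ?_⟩
      rw [hmj i hi]
      exact lt_of_le_of_ne (hlow i t) fun e => ht ⟨i, hinj i e⟩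
    · rw [Set.eq_empty_iff_forall_notMem]
      intro v hv
      have h0 := hv i₀ hbi.symm
      rw [← hmb] at h0
      by_cases hvs : v ∈ Set.range s
      · obtain ⟨j, rfl⟩ := hvs
        by_cases hj : j = i₀
        · subst hj
          exact absurd (hlow j (s b)) (not_le.2 h0)
        · by_cases hjb : j = b
          · subst hjb
            exact lt_irrefl _ h0
          · have := hv j hjb
            rw [hmj j hj] at this
            exact lt_irrefl _ this
      · exact lt_asymm h0 (hhigh i₀ b v hbi.symm hvs)
  · simp only [hY0, iff_false, Nat.not_odd_iff_even]
    obtain ⟨t, htY, ht⟩ : ∃ t ∈ Y, t ∉ Set.range s := by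
      by_contra! hcon
      refine hY0 (Finset.eq_of_subset_of_card_le ?_ ?_)
      · intro y hy
        obtain ⟨j, rfl⟩ := hcon y hy
        have := Finset.mem_image_of_mem c hy
        rw [hYc, hc] at this
        exact Finset.mem_image_of_mem _ this
      · rw [Finset.card_image_of_injective _ hsinj,
          Finset.card_erase_of_mem (Finset.mem_univ _), Finset.card_univ]
        omega
    have habove : ∀ k, (above h m k).Nonempty := fun k =>
      ⟨s k, fun i hi => ((hm i).2 t htY).trans_lt (hhigh i k t hi ht)⟩
    obtain ⟨a, b, hab, hmab⟩ : ∃ a b, a ≠ b ∧ m a = m b := by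
      have hcard : Y.card < (Finset.univ : Finset ι).card := by
        rw [Finset.card_univ]; omega
      obtain ⟨a, -, b, -, hab, e⟩ :=
        Finset.exists_ne_map_eq_of_card_lt_of_maps_to hcard (f := m) fun i _ => (hm i).1
      exact ⟨a, b, hab, e⟩
    rw [card_completions_eq_two hinj hm hY hdom hab hmab (habove a) (habove b)]
    exact even_two

/-- **Scarf's lemma.** Let finitely many points be ranked by injective functions `h i`, with a slack
point `s i` for each `i`, which is lowest in the `i`-th ranking and above all ordinary points in the
others. For every colouring in which `s i` has colour `i`, some dominating set carries each colour
exactly once. -/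
theorem exists_isDominating_colorful (hinj : ∀ i, Function.Injective (h i))
    (hlow : ∀ i v, h i (s i) ≤ h i v)
    (hhigh : ∀ i j v, i ≠ j → v ∉ Set.range s → h i v < h i (s j))
    (hc : ∀ i, c (s i) = i) (hT : ∃ t, t ∉ Set.range s) :
    ∃ X : Finset V, X.card = Fintype.card ι ∧ IsDominating h X ∧ X.image c = Finset.univ := by
  classical
  obtain ⟨i₀⟩ : Nonempty ι := inferInstance
  have hsinj : Function.Injective s := fun i j e => by rw [← hc i, ← hc j, e]
  let R : Finset (Finset V) :=
    Finset.univ.filter fun X => X.card = Fintype.card ι ∧ IsDominating h X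
  let D : Finset (Finset V) := Finset.univ.filter fun Y =>
    Y.card + 1 = Fintype.card ι ∧ IsDominating h Y ∧ Y.image c = Finset.univ.erase i₀
  -- Both sides count the pairs of a dominating set and one of its facets without the colour `i₀`.
  have hcount : ∑ X ∈ R, (X.filter fun x => (X.erase x).image c = Finset.univ.erase i₀).card =
      ∑ Y ∈ D, (Finset.univ.filter fun v => v ∉ Y ∧ IsDominating h (insert v Y)).card := by
    rw [← Finset.card_sigma, ← Finset.card_sigma]
    refine Finset.card_bij' (fun p _ => ⟨p.1.erase p.2, p.2⟩) (fun p _ => ⟨insert p.2 p.1, p.2⟩)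
      ?_ ?_ ?_ ?_
    · rintro ⟨X, x⟩ hp
      simp only [Finset.mem_sigma, R, D, Finset.mem_filter, Finset.mem_univ, true_and] at hp ⊢
      obtain ⟨⟨h1, h2⟩, h3, h4⟩ := hp
      refine ⟨⟨?_, h2.mono (Finset.erase_subset _ _), h4⟩, by simp, ?_⟩
      · rw [Finset.card_erase_add_one h3, h1]
      · rwa [Finset.insert_erase h3]
    · rintro ⟨Y, v⟩ hp
      simp only [Finset.mem_sigma, R, D, Finset.mem_filter, Finset.mem_univ, true_and] at hp ⊢
      obtain ⟨⟨h1, h2, h3⟩, h4, h5⟩ := hp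
      refine ⟨⟨by rw [Finset.card_insert_of_notMem h4, h1], h5⟩, by simp, ?_⟩
      rwa [Finset.erase_insert h4]
    · rintro ⟨X, x⟩ hp
      simp only [Finset.mem_sigma, Finset.mem_filter] at hp
      simp [Finset.insert_erase hp.2.1]
    · rintro ⟨Y, v⟩ hp
      simp only [Finset.mem_sigma, Finset.mem_filter] at hp
      simp [Finset.erase_insert hp.2.2.1]
  have hslack : (Finset.univ.erase i₀).image s ∈ D := by
    simp only [D, Finset.mem_filter, Finset.mem_univ, true_and]
    refine ⟨?_, fun v => ?_, ?_⟩
    · rw [Finset.card_image_of_injective _ hsinj, Finset.card_erase_add_one (Finset.mem_univ _),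
        Finset.card_univ]
    · by_cases hv : v ∈ Set.range s
      · obtain ⟨j, rfl⟩ := hv
        exact ⟨j, fun x _ => hlow j x⟩
      · refine ⟨i₀, fun x hx => ?_⟩
        obtain ⟨j, hj, rfl⟩ := Finset.mem_image.1 hx
        exact (hhigh i₀ j v (Finset.ne_of_mem_erase hj).symm hv).le
    · rw [Finset.image_image, show c ∘ s = id from funext hc, Finset.image_id]
  have hoddD : Odd (∑ Y ∈ D,
      (Finset.univ.filter fun v => v ∉ Y ∧ IsDominating h (insert v Y)).card) := by
    rw [Finset.odd_sum_iff_odd_card_odd]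
    convert odd_one
    rw [Finset.card_eq_one]
    refine ⟨(Finset.univ.erase i₀).image s, ?_⟩
    ext Y
    simp only [Finset.mem_filter, Finset.mem_singleton]
    constructor
    · rintro ⟨hYD, hodd⟩
      simp only [D, Finset.mem_filter, Finset.mem_univ, true_and] at hYD
      exact (odd_card_completions_iff hinj hlow hhigh hc hT i₀ Y hYD.1 hYD.2.1 hYD.2.2).1 hodd
    · rintro rfl
      have hYD := hslack
      simp only [D, Finset.mem_filter, Finset.mem_univ, true_and] at hYD
      exact ⟨hslack,
        (odd_card_completions_iff hinj hlow hhigh hc hT i₀ _ hYD.1 hYD.2.1 hYD.2.2).2 rfl⟩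
  rw [← hcount, Finset.odd_sum_iff_odd_card_odd] at hoddD
  obtain ⟨X, hX⟩ := Finset.card_pos.1 hoddD.pos
  simp only [R, Finset.mem_filter, Finset.mem_univ, true_and] at hX
  exact ⟨X, hX.1.1, hX.1.2, (odd_card_facets_iff c i₀ X hX.1.1).1 hX.2⟩

end Main

end Scarf

/-! ### Brouwer's fixed point theorem -/

namespace Scarf

variable {ι : Type*} [Fintype ι] [DecidableEq ι]

/-- The points with natural coordinates that sum up to `N`: the grid of mesh `1 / N` in the standard
simplex, scaled by `N`. -/
abbrev Grid (ι : Type*) [Fintype ι] [DecidableEq ι] (N : ℕ) : Type _ :=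
  {x : ι → ℕ // ∑ i, x i = N}

instance (N : ℕ) : Finite (Grid ι N) :=
  Finite.of_injective (β := Finset.piAntidiag (Finset.univ : Finset ι) N)
    (fun x => ⟨x.1, by simp [x.2]⟩) fun x y e => Subtype.ext (by simpa using e)

/-- The `i`-th coordinate of a grid point or of a slack point; the `i`-th slack point lies below the
grid in direction `i` and beyond it in the other directions. -/
def level {N : ℕ} (i : ι) : Grid ι N ⊕ ι → ℤ
  | .inl x => x.1 i
  | .inr j => if i = j then -1 else N + 1

theorem exists_grid_of_sum_le {N : ℕ} {C : Finset ι} (hC : C.Nonempty) (y : ι → ℕ)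
    (hy : ∑ i ∈ C, y i ≤ N) : ∃ x : Grid ι N, ∀ i ∈ C, y i ≤ x.1 i := by
  obtain ⟨k, hk⟩ := hC
  refine ⟨⟨fun i => (if i ∈ C then y i else 0) + if i = k then N - ∑ i ∈ C, y i else 0, ?_⟩, ?_⟩
  · rw [Finset.sum_add_distrib]
    simp
    omega
  · intro i hi
    simp [hi]

/-- A discrete fixed point theorem. However the grid is coloured, it has a point `y` near which all
colours `i` occur, except those with an almost vanishing coordinate `y i`. -/
theorem exists_grid_near_all_colors [Nontrivial ι] {N : ℕ} (c : Grid ι N → ι) :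
    ∃ y : Grid ι N, ∀ i, y.1 i ≤ Fintype.card ι ∨ ∃ x : Grid ι N, c x = i ∧
      ∀ j, x.1 j ≤ y.1 j + Fintype.card ι ∧ y.1 j ≤ x.1 j + Fintype.card ι := by
  classical
  have : Fintype (Grid ι N) := Fintype.ofFinite _
  let e := Fintype.equivFin (Grid ι N ⊕ ι)
  -- Ties between equal levels are broken by an arbitrary enumeration of the points.
  let h : ι → Grid ι N ⊕ ι → ℤ ×ₗ Fin (Fintype.card (Grid ι N ⊕ ι)) :=
    fun i v => toLex (level i v, e v)
  have hle : ∀ i v w, h i v ≤ h i w → level i v ≤ level i w := by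
    intro i v w hvw
    rcases Prod.Lex.toLex_le_toLex.1 hvw with h1 | h1
    exacts [h1.le, h1.1.le]
  have hlt : ∀ i v w, level i v < level i w → h i v < h i w := fun i v w hvw =>
    Prod.Lex.toLex_lt_toLex.2 (.inl hvw)
  have hcoord : ∀ (x : Grid ι N) i, x.1 i ≤ N := fun x i => by
    conv_rhs => rw [← x.2]
    exact Finset.single_le_sum (fun _ _ => Nat.zero_le _) (Finset.mem_univ i)
  obtain ⟨k⟩ : Nonempty ι := inferInstance
  obtain ⟨X, hcard, hdom, hcol⟩ := exists_isDominating_colorful (h := h) (s := Sum.inr)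
    (c := Sum.elim c id)
    (by
      intro i v w hvw
      exact e.injective (congrArg (fun p => (ofLex p).2) hvw))
    (by
      intro i v
      by_cases hv : v = Sum.inr i
      · rw [hv]
      refine (hlt _ _ _ ?_).le
      rcases v with x | j
      · simp [level]; omega
      · have : i ≠ j := fun e' => hv (by rw [e'])
        simp [level, this])
    (by
      rintro i j (x | l) hij hv
      · refine hlt _ _ _ ?_
        have := hcoord x i
        simp [level, hij]; omega
      · simp at hv)
    (by simp)
    ⟨Sum.inl ⟨fun i => if i = k then N else 0, by simp⟩, by simp⟩
  let C : Finset ι := Finset.univ.filter fun i => Sum.inr i ∉ X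
  have hdomC : ∀ t : Grid ι N, ∃ i ∈ C, ∀ x, Sum.inl x ∈ X → t.1 i ≤ x.1 i := by
    intro t
    obtain ⟨i, hi⟩ := hdom (.inl t)
    refine ⟨i, ?_, fun x hx => ?_⟩
    · simp only [C, Finset.mem_filter, Finset.mem_univ, true_and]
      intro hiX
      have := hle _ _ _ (hi _ hiX)
      simp [level] at this
      omega
    · have := hle _ _ _ (hi _ hx)
      simpa [level] using this
  have hCcol : ∀ i ∈ C, ∃ x, Sum.inl x ∈ X ∧ c x = i := by
    intro i hi
    have := Finset.mem_univ i
    rw [← hcol] at this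
    obtain ⟨v, hv, hvi⟩ := Finset.mem_image.1 this
    rcases v with x | j
    · exact ⟨x, hv, hvi⟩
    · simp only [C, Finset.mem_filter, Finset.mem_univ, true_and] at hi
      have : j = i := hvi
      exact absurd (this ▸ hv) hi
  obtain ⟨i₁, hi₁, -⟩ := hdomC ⟨fun i => if i = k then N else 0, by simp⟩
  obtain ⟨y, hyX, -⟩ := hCcol i₁ hi₁
  -- `m` is the lower corner of the grid points of `X`; its coordinates in `C` almost sum up to `N`.
  have hmin : ∀ i, ∃ z : Grid ι N, Sum.inl z ∈ X ∧ ∀ x : Grid ι N, Sum.inl x ∈ X → z.1 i ≤ x.1 i := by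
    intro i
    obtain ⟨z, hz, hz'⟩ := Finset.exists_min_image
      (Finset.univ.filter fun x : Grid ι N => Sum.inl x ∈ X) (fun x => x.1 i) ⟨y, by simpa using hyX⟩
    exact ⟨z, by simpa using hz, fun x hx => hz' x (by simpa using hx)⟩
  choose z hzX hzmin using hmin
  have hsum : N < ∑ i ∈ C, (z i).1 i + Fintype.card ι := by
    by_contra! hcon
    have : ∑ i ∈ C, ((z i).1 i + 1) ≤ N := by
      rw [Finset.sum_add_distrib]
      have : C.card ≤ Fintype.card ι := Finset.card_le_univ C
      simp
      omega
    obtain ⟨t, ht⟩ := exists_grid_of_sum_le ⟨i₁, hi₁⟩ _ this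
    obtain ⟨i, hi, hi'⟩ := hdomC t
    have := hi' _ (hzX i)
    have := ht i hi
    omega
  have hnotC : ∀ x : Grid ι N, Sum.inl x ∈ X → ∀ j ∉ C, x.1 j ≤ Fintype.card ι := by
    intro x hx j hj
    have h1 : x.1 j + ∑ i ∈ C, x.1 i ≤ N := by
      rw [← Finset.sum_insert hj]
      conv_rhs => rw [← x.2]
      exact Finset.sum_le_univ_sum_of_nonneg fun _ => Nat.zero_le _
    have h2 : ∑ i ∈ C, (z i).1 i ≤ ∑ i ∈ C, x.1 i := Finset.sum_le_sum fun i _ => hzmin i x hx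
    omega
  have hinC : ∀ x : Grid ι N, Sum.inl x ∈ X → ∀ j ∈ C, x.1 j ≤ (z j).1 j + Fintype.card ι := by
    intro x hx j hj
    have h1 : x.1 j + ∑ i ∈ C.erase j, x.1 i ≤ N := by
      rw [Finset.add_sum_erase _ _ hj]
      conv_rhs => rw [← x.2]
      exact Finset.sum_le_univ_sum_of_nonneg fun _ => Nat.zero_le _
    have h2 : ∑ i ∈ C.erase j, (z i).1 i ≤ ∑ i ∈ C.erase j, x.1 i :=
      Finset.sum_le_sum fun i _ => hzmin i x hx
    rw [← Finset.add_sum_erase _ _ hj] at hsum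
    omega
  refine ⟨y, fun i => ?_⟩
  by_cases hi : i ∈ C
  · obtain ⟨x, hxX, hxi⟩ := hCcol i hi
    refine .inr ⟨x, hxi, fun j => ?_⟩
    by_cases hj : j ∈ C
    · have h1 := hinC x hxX j hj
      have h2 := hinC y hyX j hj
      have h3 := hzmin j x hxX
      have h4 := hzmin j y hyX
      omega
    · have h1 := hnotC x hxX j hj
      have h2 := hnotC y hyX j hj
      omega
  · exact .inl (hnotC y hyX i hi)

end Scarf

/-- An approximate form of Brouwer's theorem: no coordinate decreases by more than `η`. -/
theorem exists_approx_fixedPoint_stdSimplex {ι : Type*} [Fintype ι] [Nontrivial ι]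
    {f : stdSimplex ℝ ι → stdSimplex ℝ ι} (hf : Continuous f) {η : ℝ} (hη : 0 < η) :
    ∃ y, ∀ i, y.1 i - η ≤ (f y).1 i := by
  classical
  have hu := CompactSpace.uniformContinuous_of_continuous hf
  obtain ⟨δ, hδ, hu⟩ := Metric.uniformContinuous_iff.1 hu (η / 2) (half_pos hη)
  obtain ⟨N, hN⟩ := exists_nat_gt ((Fintype.card ι : ℝ) / min δ (η / 2))
  have hmin : 0 < min δ (η / 2) := lt_min hδ (half_pos hη)
  have hN0 : (0 : ℝ) < N := lt_of_le_of_lt (by positivity) hN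
  have hNn : (Fintype.card ι : ℝ) / N < min δ (η / 2) := by
    rw [div_lt_iff₀ hmin] at hN
    rw [div_lt_iff₀ hN0]
    linarith [mul_comm (N : ℝ) (min δ (η / 2))]
  let g : Scarf.Grid ι N → stdSimplex ℝ ι := fun x => ⟨fun i => x.1 i / N,
    fun i => by positivity, by
      rw [← Finset.sum_div, ← Nat.cast_sum, x.2, div_self hN0.ne']⟩
  have hcol : ∀ x, ∃ i, (g x).1 i ≤ (f (g x)).1 i := by
    intro x
    obtain ⟨i, -, hi⟩ := Finset.exists_le_of_sum_le (s := Finset.univ) (f := (g x).1)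
      (g := (f (g x)).1) Finset.univ_nonempty (by rw [(g x).2.2, (f (g x)).2.2])
    exact ⟨i, hi⟩
  choose c hc using hcol
  obtain ⟨y, hy⟩ := Scarf.exists_grid_near_all_colors c
  refine ⟨g y, fun i => ?_⟩
  rcases hy i with hi | ⟨x, hxi, hx⟩
  · have h1 : (g y).1 i ≤ Fintype.card ι / N := by
      simp only [g]
      gcongr
    have h2 := (f (g y)).2.1 i
    have := min_le_right δ (η / 2)
    linarith
  · have hd : ∀ j, |(g x).1 j - (g y).1 j| ≤ Fintype.card ι / N := by
      intro j
      obtain ⟨h1, h2⟩ := hx j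
      have h1' : (x.1 j : ℝ) ≤ y.1 j + Fintype.card ι := by exact_mod_cast h1
      have h2' : (y.1 j : ℝ) ≤ x.1 j + Fintype.card ι := by exact_mod_cast h2
      simp only [g]
      rw [← sub_div, abs_div, abs_of_pos hN0]
      gcongr
      rw [abs_le]
      constructor <;> linarith
    have hdist : dist (g x) (g y) < δ :=
      lt_of_le_of_lt ((dist_pi_le_iff (by positivity)).2 hd) (hNn.trans_le (min_le_left _ _))
    have h3 := (dist_le_pi_dist (f (g x)).1 (f (g y)).1 i).trans_lt (hu hdist)
    have h4 := hc x
    rw [hxi] at h4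
    have h5 := hd i
    rw [Real.dist_eq, abs_lt] at h3
    rw [abs_le] at h5
    have := min_le_right δ (η / 2)
    linarith

/-- **Brouwer's fixed point theorem** for the standard simplex. -/
theorem exists_fixedPoint_stdSimplex {ι : Type*} [Fintype ι] [Nonempty ι]
    {f : stdSimplex ℝ ι → stdSimplex ℝ ι} (hf : Continuous f) : ∃ y, f y = y := by
  classical
  have : Nonempty (stdSimplex ℝ ι) :=
    ⟨⟨_, single_mem_stdSimplex ℝ (Classical.arbitrary ι)⟩⟩
  rcases subsingleton_or_nontrivial ι with hι | hι
  · obtain ⟨y⟩ := this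
    refine ⟨y, Subtype.ext (funext fun i => ?_)⟩
    have h1 := (f y).2.2
    have h2 := y.2.2
    rw [Fintype.sum_subsingleton _ i] at h1 h2
    rw [h1, h2]
  -- The largest decrease of a coordinate is minimized on the simplex.
  have hcont : Continuous fun y : stdSimplex ℝ ι =>
      Finset.univ.sup' Finset.univ_nonempty fun i => y.1 i - (f y).1 i :=
    Continuous.finset_sup'_apply _ fun i _ =>
      ((continuous_apply i).comp continuous_subtype_val).sub
        ((continuous_apply i).comp (continuous_subtype_val.comp hf))
  obtain ⟨y, -, hmin⟩ := isCompact_univ.exists_isMinOn Set.univ_nonempty hcont.continuousOn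
  have hle : ∀ i, y.1 i ≤ (f y).1 i := by
    intro i
    refine le_of_forall_pos_le_add fun η hη => ?_
    obtain ⟨z, hzη⟩ := exists_approx_fixedPoint_stdSimplex hf hη
    have h1 := Finset.le_sup' (fun i => y.1 i - (f y).1 i) (Finset.mem_univ i)
    have h2 := isMinOn_iff.1 hmin z (Set.mem_univ z)
    have h3 : (Finset.univ.sup' Finset.univ_nonempty fun i => z.1 i - (f z).1 i) ≤ η :=
      Finset.sup'_le _ _ fun i _ => by linarith [hzη i]
    linarith
  refine ⟨y, Subtype.ext (funext fun i => ?_)⟩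
  have hsum : ∑ i, y.1 i = ∑ i, (f y).1 i := by rw [y.2.2, (f y).2.2]
  exact ((Finset.sum_eq_sum_iff_of_le fun i _ => hle i).1 hsum i (Finset.mem_univ i)).symm

/-! ### Baire probability measures -/

namespace DefensiveForecasting

open MeasureTheory

variable {Ω : Type*} [TopologicalSpace Ω]

theorem measurable_baire (g : C(Ω, ℝ)) : @Measurable Ω ℝ (baireSigmaAlgebra Ω) _ g := by
  rw [measurable_iff_comap_le, BorelSpace.measurable_eq (α := ℝ)]
  exact le_iSup (fun g : C(Ω, ℝ) => MeasurableSpace.comap (fun ω => g ω) (borel ℝ)) g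

theorem baireSigmaAlgebra_le_borel : baireSigmaAlgebra Ω ≤ borel Ω := by
  refine iSup_le fun g => ?_
  borelize Ω
  rw [← BorelSpace.measurable_eq (α := ℝ)]
  exact g.continuous.measurable.comap_le

namespace Prob

theorem integral_smul (p : Prob Ω) (a : ℝ) (g : C(Ω, ℝ)) :
    p.integral (a • g : C(Ω, ℝ)) = a * p.integral g :=
  MeasureTheory.integral_const_mul a g

theorem integral_const (p : Prob Ω) (a : ℝ) : p.integral (ContinuousMap.const Ω a) = a := by
  let _ := baireSigmaAlgebra Ω
  have : IsProbabilityMeasure p.1 := p.2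
  exact (MeasureTheory.integral_const a).trans (by simp)

section Compact

variable [CompactSpace Ω]

theorem integrable (p : Prob Ω) (g : C(Ω, ℝ)) :
    Integrable[baireSigmaAlgebra Ω] g p.1 := by
  let _ := baireSigmaAlgebra Ω
  have : IsProbabilityMeasure p.1 := p.2
  exact .of_bound (measurable_baire g).aestronglyMeasurable ‖g‖ (.of_forall g.norm_coe_le_norm)

theorem integral_add (p : Prob Ω) (f g : C(Ω, ℝ)) :
    p.integral (f + g : C(Ω, ℝ)) = p.integral f + p.integral g :=
  MeasureTheory.integral_add (p.integrable f) (p.integrable g)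

theorem integral_mono (p : Prob Ω) {f g : C(Ω, ℝ)} (h : ∀ ω, f ω ≤ g ω) :
    p.integral f ≤ p.integral g :=
  MeasureTheory.integral_mono (p.integrable f) (p.integrable g) h

/-- **Riesz representation** for the Baire `σ`-algebra: a normalized positive linear functional on
the continuous functions is the integral with respect to a Baire probability measure, namely the
restriction of its Riesz measure to the Baire sets. -/
theorem exists_integral_eq [T2Space Ω] (L : C(Ω, ℝ) → ℝ)
    (hadd : ∀ f g, L (f + g) = L f + L g) (hsmul : ∀ (a : ℝ) g, L (a • g) = a * L g)
    (hpos : ∀ g : C(Ω, ℝ), (∀ ω, 0 ≤ g ω) → 0 ≤ L g) (hone : L 1 = 1) :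
    ∃ p : Prob Ω, ∀ g : C(Ω, ℝ), p.integral g = L g := by
  let mB : MeasurableSpace Ω := borel Ω
  have : BorelSpace Ω := ⟨rfl⟩
  let Λ : CompactlySupportedContinuousMap Ω ℝ →ₚ[ℝ] ℝ := PositiveLinearMap.mk₀
    { toFun := fun g => L g
      map_add' := fun f g => hadd f g
      map_smul' := fun a g => hsmul a g }
    fun g hg => hpos _ hg
  have hΛ : ∀ g : C(Ω, ℝ), ∫ ω, g ω ∂(RealRMK.rieszMeasure Λ) = L g := fun g =>
    RealRMK.integral_rieszMeasure Λ (CompactlySupportedContinuousMap.continuousMapEquiv g)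
  set μ := RealRMK.rieszMeasure Λ
  have huniv : μ Set.univ = 1 := by
    have h1 : μ.real Set.univ = 1 := by simpa [hone] using hΛ 1
    rw [measureReal_def, ENNReal.toReal_eq_one_iff] at h1
    exact h1
  refine ⟨⟨μ.trim baireSigmaAlgebra_le_borel, ⟨?_⟩⟩, fun g => ?_⟩
  · rw [trim_measurableSet_eq _ (@MeasurableSet.univ Ω (baireSigmaAlgebra Ω)), huniv]
  · rw [← hΛ g]
    exact (integral_trim baireSigmaAlgebra_le_borel (measurable_baire g).stronglyMeasurable).symm

end Compact

/-- The family of all integrals of continuous functions against a given measure. -/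
noncomputable def toFunctional (p : Prob Ω) (g : C(Ω, ℝ)) : ℝ := p.integral g

theorem isInducing_toFunctional : Topology.IsInducing (toFunctional (Ω := Ω)) := ⟨rfl⟩

theorem continuous_iff {X : Type*} [TopologicalSpace X] {φ : X → Prob Ω} :
    Continuous φ ↔ ∀ g : C(Ω, ℝ), Continuous fun x => (φ x).integral g :=
  isInducing_toFunctional.continuous_iff.trans continuous_pi_iff

/-- The weak-star topology is Hausdorff, but the weaker separation property below is immediate and
already makes a compact space normal, as partitions of unity require. -/
instance : R1Space (Prob Ω) := isInducing_toFunctional.r1Space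

variable [CompactSpace Ω] [T2Space Ω]

/-- The functionals given by probability measures are cut out by closed conditions, and the `g`-th
coordinate takes values in `[-‖g‖, ‖g‖]`, so compactness follows from Tychonoff's theorem. -/
instance : CompactSpace (Prob Ω) := by
  let K : Set (C(Ω, ℝ) → ℝ) := {L | (∀ f g, L (f + g) = L f + L g) ∧
    (∀ (a : ℝ) g, L (a • g) = a * L g) ∧ (∀ g : C(Ω, ℝ), (∀ ω, 0 ≤ g ω) → 0 ≤ L g) ∧ L 1 = 1}
  have hrange : Set.range (toFunctional (Ω := Ω)) = K := by
    ext L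
    constructor
    · rintro ⟨p, rfl⟩
      refine ⟨p.integral_add, p.integral_smul, fun g hg => ?_, p.integral_const 1⟩
      rw [← p.integral_const 0]
      exact p.integral_mono hg
    · rintro ⟨h1, h2, h3, h4⟩
      obtain ⟨p, hp⟩ := exists_integral_eq L h1 h2 h3 h4
      exact ⟨p, funext hp⟩
  have hclosed : IsClosed K := by
    simp only [K, Set.ofPred_and, Set.ofPred_forall]
    refine IsClosed.inter ?_ (IsClosed.inter ?_ (IsClosed.inter ?_ ?_))
    · exact isClosed_iInter fun f => isClosed_iInter fun g =>
        isClosed_eq (continuous_apply _) ((continuous_apply f).add (continuous_apply g))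
    · exact isClosed_iInter fun a => isClosed_iInter fun g =>
        isClosed_eq (continuous_apply _) (continuous_const.mul (continuous_apply _))
    · exact isClosed_iInter fun g => isClosed_iInter fun _ =>
        isClosed_le continuous_const (continuous_apply _)
    · exact isClosed_eq (continuous_apply _) continuous_const
  have hbox : K ⊆ Set.univ.pi fun g : C(Ω, ℝ) => Set.Icc (-‖g‖) ‖g‖ := by
    rw [← hrange]
    rintro _ ⟨p, rfl⟩ g -
    have hg : ∀ ω, -‖g‖ ≤ g ω ∧ g ω ≤ ‖g‖ := fun ω => abs_le.1 (g.norm_coe_le_norm ω)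
    constructor
    · rw [← p.integral_const (-‖g‖)]
      exact p.integral_mono fun ω => (hg ω).1
    · rw [← p.integral_const ‖g‖]
      exact p.integral_mono fun ω => (hg ω).2
  have hK : IsCompact K :=
    (isCompact_univ_pi fun g => isCompact_Icc).of_isClosed_subset hclosed hbox
  refine ⟨isInducing_toFunctional.isCompact_iff.2 ?_⟩
  rwa [Set.image_univ, hrange]

/-- Mixtures of probability measures. -/
theorem exists_mixture {κ : Type*} [Fintype κ] (q : κ → Prob Ω) {w : κ → ℝ}
    (hw : w ∈ stdSimplex ℝ κ) :
    ∃ p : Prob Ω, ∀ g : C(Ω, ℝ), p.integral g = ∑ k, w k * (q k).integral g := by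
  refine exists_integral_eq _ (fun f g => ?_) (fun a g => ?_) (fun g hg => ?_) ?_
  · simp only [integral_add, mul_add, Finset.sum_add_distrib]
  · simp only [integral_smul, Finset.mul_sum]
    exact Finset.sum_congr rfl fun k _ => by ring
  · refine Finset.sum_nonneg fun k _ => mul_nonneg (hw.1 k) ?_
    rw [← (q k).integral_const 0]
    exact (q k).integral_mono hg
  · rw [← hw.2]
    refine Finset.sum_congr rfl fun k _ => ?_
    rw [show (1 : C(Ω, ℝ)) = ContinuousMap.const Ω 1 from rfl, integral_const, mul_one]

end Prob

end DefensiveForecasting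

/-! ### Minimax, Carathéodory's theorem and the forecast -/

namespace DefensiveForecasting

section Duality

variable {Ω : Type*} [TopologicalSpace Ω] [CompactSpace Ω] [T2Space Ω]

/-- A minimax duality: if no mixture of the functions in `F` is everywhere below `δ`, then some
probability measure gives them all an integral of at least `δ`. The measure represents a functional
that separates the convex hull of `F` from the functions below `δ`. -/
theorem exists_prob_forall_le_integral {F : Set C(Ω, ℝ)} (hF : F.Nonempty) {δ : ℝ}
    (h : ∀ g ∈ convexHull ℝ F, ∃ ω, δ ≤ g ω) :
    ∃ q : Prob Ω, ∀ g ∈ F, δ ≤ q.integral g := by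
  let B : Set C(Ω, ℝ) := {g | ∀ ω, g ω < δ}
  have hBopen : IsOpen B := by
    have := ContinuousMap.isOpen_setOfPred_mapsTo (X := Ω) (Y := ℝ) isCompact_univ
      (isOpen_Iio (a := δ))
    convert this using 1
    ext g
    simp [B, Set.MapsTo]
  have hBconv : Convex ℝ B := by
    intro f hf g hg a b ha hb hab ω
    have h1 := hf ω
    have h2 := hg ω
    change a * f ω + b * g ω < δ
    exact convex_Iio δ h1 h2 ha hb hab
  obtain ⟨Λ, u, hΛB, hΛF⟩ := geometric_hahn_banach_open hBconv hBopen (convex_convexHull ℝ F)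
    (Set.disjoint_left.2 fun g hgB hgF => by
      obtain ⟨ω, hω⟩ := h g hgF
      exact absurd (hgB ω) (not_lt.2 hω))
  have hconst : ∀ c < δ, c * Λ 1 < u := by
    intro c hc
    rw [← smul_eq_mul, ← map_smul]
    exact hΛB _ fun ω => by simpa using hc
  have hpos : ∀ g : C(Ω, ℝ), (∀ ω, 0 ≤ g ω) → 0 ≤ Λ g := by
    intro g hg
    by_contra! hneg
    -- A large negative multiple of `g` would lie in `B` and violate the separation.
    have hbound : ∀ t : ℝ, 0 ≤ t → (δ - 1) * Λ 1 - t * Λ g < u := by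
      intro t ht
      have := hΛB ((δ - 1) • (1 : C(Ω, ℝ)) - t • g) fun ω => by
        have := mul_nonneg ht (hg ω)
        simp
        linarith
      simpa using this
    have hb := hbound (|u - (δ - 1) * Λ 1| / (-Λ g)) (by
      have : 0 < -Λ g := by linarith
      positivity)
    have he : |u - (δ - 1) * Λ 1| / (-Λ g) * Λ g = -|u - (δ - 1) * Λ 1| := by
      rw [div_neg, neg_mul, div_mul_cancel₀ _ hneg.ne]
    rw [he] at hb
    linarith [le_abs_self (u - (δ - 1) * Λ 1)]
  have hone : 0 < Λ 1 := by
    refine lt_of_le_of_ne (hpos 1 fun ω => zero_le_one) fun h0 => ?_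
    obtain ⟨g, hg⟩ := hF
    -- A positive functional that vanishes at `1` vanishes, so it separates nothing.
    have hzero : Λ g ≤ 0 := by
      have := hpos (‖g‖ • (1 : C(Ω, ℝ)) - g) fun ω => by
        have := (abs_le.1 (g.norm_coe_le_norm ω)).2
        simp
        linarith
      simpa [← h0] using this
    have h1 := hconst (δ - 1) (by linarith)
    rw [← h0, mul_zero] at h1
    exact absurd (h1.trans_le (hΛF g (subset_convexHull ℝ F hg))) (not_lt.2 hzero)
  have hδu : δ * Λ 1 ≤ u := by
    refine le_of_forall_lt fun c hc => ?_
    have h1 : c / Λ 1 < δ := by rwa [div_lt_iff₀ hone]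
    simpa [hone.ne'] using hconst _ h1
  obtain ⟨q, hq⟩ := Prob.exists_integral_eq (fun g => Λ g / Λ 1)
    (fun f g => by simp [add_div]) (fun a g => by simp [mul_div_assoc])
    (fun g hg => div_nonneg (hpos g hg) hone.le) (div_self hone.ne')
  refine ⟨q, fun g hg => ?_⟩
  rw [hq, le_div_iff₀ hone]
  exact hδu.trans (hΛF g (subset_convexHull ℝ F hg))

/-- Sceptic's function at a given forecast, as an element of the space of continuous functions. -/
def ScepticMove.gain (S : ScepticMove Ω) (p : Prob Ω) : C(Ω, ℝ) :=
  ⟨fun ω => S.toFun ω p, S.continuous_left p⟩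

/-- Inside some element of an open cover there are forecasts with a mixture that leaves Sceptic a
gain of less than `δ` whatever Reality does. Otherwise each element `U` has a measure `q U` to which
Sceptic's function at any forecast in `U` gives an integral of at least `δ`; gluing these measures
by a partition of unity gives a continuous self-map whose fixed point `p` satisfies
`δ ≤ ∫ S(ω, p) p(dω)`. -/
theorem ScepticMove.exists_mem_convexHull_lt [Nonempty Ω] (S : ScepticMove Ω) {δ : ℝ} (hδ : 0 < δ)
    {A : Set (Set (Prob Ω))} (hopen : ∀ U ∈ A, IsOpen U) (hcover : ⋃₀ A = Set.univ) :
    ∃ U ∈ A, ∃ g ∈ convexHull ℝ (S.gain '' U), ∀ ω, g ω < δ := by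
  by_contra! hcon
  have hx : ∀ x : Prob Ω, ∃ U ∈ A, x ∈ U := fun x => by
    rw [← Set.mem_sUnion, hcover]
    exact Set.mem_univ x
  choose U hUA hxU using hx
  have hq : ∀ x, ∃ q : Prob Ω, ∀ p ∈ U x, δ ≤ q.integral (S.gain p) := by
    intro x
    obtain ⟨q, hq⟩ := exists_prob_forall_le_integral (F := S.gain '' U x) (δ := δ)
      ⟨_, x, hxU x, rfl⟩ (hcon _ (hUA x))
    exact ⟨q, fun p hp => hq _ ⟨p, hp, rfl⟩⟩
  choose q hq using hq
  obtain ⟨t, -, ht⟩ := isCompact_univ.elim_nhds_subcover U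
    fun x _ => (hopen _ (hUA x)).mem_nhds (hxU x)
  obtain ⟨φ, hφ⟩ := PartitionOfUnity.exists_isSubordinate isClosed_univ (fun k : t => U k)
    (fun k => hopen _ (hUA k)) (by
      intro x hx
      simpa using ht hx)
  have hsum : ∀ x, ∑ k, φ k x = 1 := fun x => by
    rw [← finsum_eq_sum_of_fintype]
    exact φ.sum_eq_one (Set.mem_univ x)
  choose mix hmix using fun w : stdSimplex ℝ t => Prob.exists_mixture (fun k : t => q k) w.2
  have hmixcont : Continuous mix := by
    refine Prob.continuous_iff.2 fun g => ?_
    simp only [hmix]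
    exact continuous_finsetSum _ fun k _ =>
      ((continuous_apply k).comp continuous_subtype_val).mul continuous_const
  have : Nonempty t := by
    obtain ⟨ω⟩ := ‹Nonempty Ω›
    obtain ⟨x, -⟩ := Prob.exists_integral_eq (fun g : C(Ω, ℝ) => g ω) (fun _ _ => rfl)
      (fun _ _ => rfl) (fun _ hg => hg ω) rfl
    obtain ⟨k, hk⟩ := Set.mem_iUnion.1 (ht (Set.mem_univ x))
    exact ⟨k, (Set.mem_iUnion.1 hk).1⟩
  obtain ⟨w, hw⟩ := exists_fixedPoint_stdSimplex (ι := t)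
    (f := fun w => ⟨fun k => φ k (mix w), fun k => φ.nonneg k _, hsum _⟩)
    ((continuous_pi fun k => (φ k).continuous.comp hmixcont).subtype_mk _)
  have hw' : ∀ k, φ k (mix w) = w.1 k := fun k => congrFun (congrArg Subtype.val hw) k
  have hle : δ ≤ (mix w).integral (S.gain (mix w)) := by
    rw [hmix, ← one_mul δ, ← w.2.2, Finset.sum_mul]
    refine Finset.sum_le_sum fun k _ => ?_
    rcases (w.2.1 k).eq_or_lt with h0 | h0
    · simp [← h0]
    · refine mul_le_mul_of_nonneg_left (hq _ _ (hφ k (subset_closure ?_))) h0.le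
      simp [hw', h0.ne']
  exact absurd (hle.trans (S.integral_nonpos (mix w))) (not_le.2 hδ)

end Duality

section Caratheodory

/-- **Carathéodory's theorem** for cones, in the form needed here: if a nonnegative combination of
vectors in `ℝ^Ω` is strictly negative, at most `|Ω|` of the vectors have such a combination. -/
theorem exists_card_le_sum_neg {Ω κ : Type*} [Fintype Ω] [DecidableEq κ] (a : κ → Ω → ℝ)
    (t : Finset κ) (w : κ → ℝ) (hw : ∀ i ∈ t, 0 ≤ w i) (hneg : ∀ ω, ∑ i ∈ t, w i * a i ω < 0) :
    ∃ t' ⊆ t, t'.card ≤ Fintype.card Ω ∧ ∃ w' : κ → ℝ, (∀ i ∈ t', 0 ≤ w' i) ∧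
      ∀ ω, ∑ i ∈ t', w' i * a i ω < 0 := by
  induction t using Finset.strongInduction generalizing w with
  | H t ih =>
    by_cases hcard : t.card ≤ Fintype.card Ω
    · exact ⟨t, subset_rfl, hcard, w, hw, hneg⟩
    obtain ⟨v, hv0, k, hk, hvk⟩ : ∃ v : κ → ℝ, (∀ ω, ∑ i ∈ t, v i * a i ω = 0) ∧
        ∃ k ∈ t, 0 < v k := by
      have hdep : ¬ LinearIndependent ℝ fun i : t => a i := by
        intro hli
        have := hli.fintype_card_le_finrank
        simp at this
        omega
      obtain ⟨g, hg, k, hk⟩ := Fintype.not_linearIndependent_iff.1 hdep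
      have key : ∀ g : t → ℝ, ∑ i, g i • a i = 0 → 0 < g k →
          ∃ v : κ → ℝ, (∀ ω, ∑ i ∈ t, v i * a i ω = 0) ∧ ∃ k ∈ t, 0 < v k := by
        intro g hg hk
        refine ⟨fun i => if hi : i ∈ t then g ⟨i, hi⟩ else 0, fun ω => ?_, k, k.2, by simpa using hk⟩
        rw [← Finset.sum_coe_sort]
        simpa using congrFun hg ω
      rcases hk.lt_or_gt with h | h
      · exact key (fun i => -g i) (by simpa only [neg_smul, Finset.sum_neg_distrib, neg_eq_zero] using hg)
          (by simpa using h)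
      · exact key g hg h
    -- Move along the dependency `v` until the first weight vanishes.
    obtain ⟨j, hj, hmin⟩ := Finset.exists_min_image (t.filter fun i => 0 < v i)
      (fun i => w i / v i) ⟨k, by simp [hk, hvk]⟩
    obtain ⟨hjt, hvj⟩ := Finset.mem_filter.1 hj
    have hzero : w j - w j / v j * v j = 0 := by
      rw [div_mul_cancel₀ _ hvj.ne', sub_self]
    obtain ⟨t', ht', hrest⟩ := ih (t.erase j) (Finset.erase_ssubset hjt)
      (fun i => w i - w j / v j * v i)
      (fun i hi => by
        have hit := Finset.mem_of_mem_erase hi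
        have h0 : 0 ≤ w j / v j := div_nonneg (hw j hjt) hvj.le
        rcases le_or_gt (v i) 0 with h | h
        · nlinarith [hw i hit]
        · have := hmin i (by simp [hit, h])
          rw [le_div_iff₀ h] at this
          linarith)
      (fun ω => by
        have : ∑ i ∈ t.erase j, (w i - w j / v j * v i) * a i ω =
            ∑ i ∈ t, (w i - w j / v j * v i) * a i ω :=
          Finset.sum_erase _ (by rw [hzero, zero_mul])
        rw [this]
        simp only [sub_mul, Finset.sum_sub_distrib, mul_assoc, ← Finset.mul_sum, hv0]
        simpa using hneg ω)
    exact ⟨t', ht'.trans (Finset.erase_subset _ _), hrest⟩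

end Caratheodory

section FinProb

universe u

variable {X : Type u}

theorem FinProb.integral_sub_const (P : FinProb X) (f : X → ℝ) (c : ℝ) :
    P.integral (fun x => f x - c) = P.integral f - c := by
  have : ∑ x ∈ P.carrier, P.weights x = 1 := P.total
  simp only [FinProb.integral, mul_sub, Finset.sum_sub_distrib, ← Finset.sum_mul, this, one_mul]

theorem FinProb.integral_div_const (P : FinProb X) (f : X → ℝ) (c : ℝ) :
    P.integral (fun x => f x / c) = P.integral f / c := by
  simp only [FinProb.integral, Finset.sum_div, mul_div_assoc]

/-- The distribution of a family `x` of points whose index is drawn with probabilities `w`. -/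
theorem FinProb.exists_integral_eq_sum {κ : Type*} (t : Finset κ) (x : κ → X) (w : κ → ℝ)
    (hw : ∀ i ∈ t, 0 ≤ w i) (hsum : ∑ i ∈ t, w i = 1) :
    ∃ P : FinProb X, (∀ y ∈ P.carrier, ∃ i ∈ t, x i = y) ∧ P.carrier.card ≤ t.card ∧
      ∀ f, P.integral f = ∑ i ∈ t, w i * f (x i) := by
  classical
  have hint : ∀ f : X → ℝ, (∑ i ∈ t, Finsupp.single (x i) (w i)).sum (fun y a => a * f y) =
      ∑ i ∈ t, w i * f (x i) := by
    intro f
    rw [← Finsupp.sum_finsetSum_index (by simp) (by intros; ring)]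
    exact Finset.sum_congr rfl fun i _ => Finsupp.sum_single_index (by simp)
  let P : FinProb X :=
    { weights := ∑ i ∈ t, Finsupp.single (x i) (w i)
      nonneg := Finset.sum_nonneg fun i hi => Finsupp.single_nonneg.2 (hw i hi)
      total := by simpa [hsum] using hint fun _ => 1 }
  have hsub : P.carrier ⊆ t.image x := by
    refine Finsupp.support_finsetSum.trans (Finset.biUnion_subset.2 fun i hi => ?_)
    exact Finsupp.support_single_subset.trans
      (Finset.singleton_subset_iff.2 (Finset.mem_image_of_mem x hi))
  exact ⟨P, fun y hy => Finset.mem_image.1 (hsub hy),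
    (Finset.card_le_card hsub).trans Finset.card_image_le, hint⟩

end FinProb

section Forecast

variable {Ω : Type*} [TopologicalSpace Ω] [CompactSpace Ω] [T2Space Ω] [Nonempty Ω]

/-- The randomized forecast of a single round. -/
theorem ScepticMove.exists_forecast (S : ScepticMove Ω) {δ : ℝ} (hδ : 0 < δ)
    {A : Set (Set (Prob Ω))} (hopen : ∀ U ∈ A, IsOpen U) (hcover : ⋃₀ A = Set.univ) :
    ∃ P : FinProb (Prob Ω), (∃ U ∈ A, (P.carrier : Set (Prob Ω)) ⊆ U) ∧
      (P.carrier.card : ℕ∞) ≤ ENat.card Ω ∧ ∀ ω, P.integral (S.toFun ω) < δ := by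
  classical
  obtain ⟨U, hU, g, hg, hgδ⟩ := S.exists_mem_convexHull_lt hδ hopen hcover
  rw [convexHull_eq] at hg
  obtain ⟨κ, t, w, z, hw, hw1, hz, hcm⟩ := hg
  have hx : ∀ i, ∃ p, i ∈ t → p ∈ U ∧ S.gain p = z i := by
    intro i
    by_cases hi : i ∈ t
    · obtain ⟨p, hp⟩ := hz i hi
      exact ⟨p, fun _ => hp⟩
    · obtain ⟨k, hk⟩ : t.Nonempty := by
        rw [Finset.nonempty_iff_ne_empty]
        rintro rfl
        simp at hw1
      obtain ⟨p, hp⟩ := hz k hk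
      exact ⟨p, fun h => absurd h hi⟩
  choose x hx using hx
  -- Subtracting `δ` from Sceptic's gains makes the condition homogeneous in the weights.
  have hneg : ∀ ω, ∑ i ∈ t, w i * (S.toFun ω (x i) - δ) < 0 := by
    intro ω
    have h1 : ∑ i ∈ t, w i * S.toFun ω (x i) = g ω := by
      rw [← hcm, Finset.centerMass_eq_of_sum_1 _ _ hw1, ContinuousMap.sum_apply]
      refine Finset.sum_congr rfl fun i hi => ?_
      rw [← (hx i hi).2]
      rfl
    simp only [mul_sub, Finset.sum_sub_distrib, ← Finset.sum_mul, hw1, h1]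
    linarith [hgδ ω]
  obtain ⟨t', ht', hcard, w', hw', hneg'⟩ : ∃ t' ⊆ t, (t'.card : ℕ∞) ≤ ENat.card Ω ∧
      ∃ w' : κ → ℝ, (∀ i ∈ t', 0 ≤ w' i) ∧
        ∀ ω, ∑ i ∈ t', w' i * (S.toFun ω (x i) - δ) < 0 := by
    cases finite_or_infinite Ω
    · have := Fintype.ofFinite Ω
      obtain ⟨t', ht', hcard, h⟩ :=
        exists_card_le_sum_neg (fun i ω => S.toFun ω (x i) - δ) t w hw hneg
      exact ⟨t', ht', by simpa using hcard, h⟩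
    · exact ⟨t, subset_rfl, by simp, w, hw, hneg⟩
  obtain ⟨ω₀⟩ := ‹Nonempty Ω›
  have hW : 0 < ∑ i ∈ t', w' i := by
    refine lt_of_le_of_ne (Finset.sum_nonneg hw') fun h0 => ?_
    have hzero := (Finset.sum_eq_zero_iff_of_nonneg hw').1 h0.symm
    have := hneg' ω₀
    rw [Finset.sum_eq_zero fun i hi => by rw [hzero i hi, zero_mul]] at this
    exact lt_irrefl _ this
  obtain ⟨P, hP, hPcard, hPint⟩ := FinProb.exists_integral_eq_sum t' x
    (fun i => w' i / ∑ i ∈ t', w' i) (fun i hi => div_nonneg (hw' i hi) hW.le)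
    (by rw [← Finset.sum_div, div_self hW.ne'])
  refine ⟨P, ⟨U, hU, fun y hy => ?_⟩, (Nat.cast_le.2 hPcard).trans hcard, fun ω => ?_⟩
  · obtain ⟨i, hi, rfl⟩ := hP y hy
    exact (hx i (ht' hi)).1
  · rw [← sub_neg, ← FinProb.integral_sub_const, hPint]
    simp only [div_mul_eq_mul_div, ← Finset.sum_div]
    exact div_neg_of_neg_of_pos (hneg' ω) hW

end Forecast

end DefensiveForecasting

/-! ### Forecaster's strategy -/

theorem theorem2 {Ω : Type*} [TopologicalSpace Ω] [CompactSpace Ω] [T2Space Ω] [Nonempty Ω]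
    (ε : ℝ) (hε : 0 < ε)
    (𝒜 : ℕ → Set (Set (DefensiveForecasting.Prob Ω)))
    (h𝒜_open : ∀ n, ∀ U ∈ 𝒜 n, IsOpen U)
    (h𝒜_cover : ∀ n, ⋃₀ 𝒜 n = Set.univ) :
    ∃ σ : DefensiveForecasting.ForecasterStrategy Ω,
      ∀ r : ℕ → DefensiveForecasting.Round Ω,
        (∀ n, DefensiveForecasting.FollowsAt σ r n) →
        (∀ n, DefensiveForecasting.OpponentsLegalAt r n) →
        (∀ n, DefensiveForecasting.ForecasterLegalAt r n) ∧
        (∀ n, DefensiveForecasting.scepticCapital r n ≤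
          (1 + ε) * DefensiveForecasting.forecasterCapital r n) ∧
        (∀ n, ∃ U ∈ 𝒜 n, ((r n).P.carrier : Set (DefensiveForecasting.Prob Ω)) ⊆ U) ∧
        (∀ n, ((r n).P.carrier.card : ℕ∞) ≤ ENat.card Ω) := by
  have hε1 : 0 < 1 + ε := by linarith
  choose forecast hU hcard hgain using fun (n : ℕ) (S : DefensiveForecasting.ScepticMove Ω) =>
    S.exists_forecast (δ := ε / 2 ^ (n + 1)) (by positivity) (h𝒜_open n) (h𝒜_cover n)
  -- Forecaster stakes the fraction `1 / (1 + ε)` of Sceptic's bet, made fair for the lottery `P`.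
  refine ⟨⟨fun n _ S => forecast n S,
    fun _ _ S P ω p => (S.toFun ω p - P.integral (S.toFun ω)) / (1 + ε)⟩, fun r hσ hopp => ?_⟩
  have hP : ∀ n, (r n).P = forecast n (r n).S := fun n => (hσ n).1
  have hf : ∀ n p, (1 + ε) * (r n).f p =
      (r n).S.toFun (r n).ω p - (r n).P.integral ((r n).S.toFun (r n).ω) := fun n p => by
    rw [(hσ n).2]
    exact mul_div_cancel₀ _ hε1.ne'
  have hloss : ∀ n, (r n).P.integral ((r n).S.toFun (r n).ω) < ε / 2 ^ (n + 1) := fun n => by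
    rw [hP n]
    exact hgain n _ _
  have hhalf : ∀ n : ℕ, ε / 2 ^ n = ε / 2 ^ (n + 1) + ε / 2 ^ (n + 1) := fun n => by
    rw [pow_succ]
    field_simp
    norm_num
  -- Of the initial reserve `ε`, the part `ε / 2 ^ n` is left after `n` rounds.
  have hinv : ∀ n, DefensiveForecasting.scepticCapital r n + ε / 2 ^ n ≤
      (1 + ε) * DefensiveForecasting.forecasterCapital r n := by
    intro n
    induction n with
    | zero => simp [DefensiveForecasting.scepticCapital, DefensiveForecasting.forecasterCapital]
    | succ n ih =>
      simp only [DefensiveForecasting.scepticCapital, DefensiveForecasting.forecasterCapital,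
        mul_add, hf]
      linarith [hloss n, hhalf n, mul_add 1 ε (DefensiveForecasting.forecasterCapital r n)]
  refine ⟨fun n => ⟨?_, fun p _ => ?_⟩, fun n => ?_, fun n => ?_, fun n => ?_⟩
  · rw [(hσ n).2]
    simp only [DefensiveForecasting.FinProb.integral_div_const,
      DefensiveForecasting.FinProb.integral_sub_const, sub_self, zero_div, le_refl]
  · refine nonneg_of_mul_nonneg_right ?_ hε1
    rw [mul_add, hf]
    have hpos : 0 < ε / 2 ^ (n + 1) := by positivity
    linarith [(hopp n).1 (r n).ω p, hinv n, hloss n, hhalf n]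
  · have : 0 < ε / 2 ^ n := by positivity
    linarith [hinv n]
  · rw [hP n]
    exact hU n _
  · rw [hP n]
    exact hcard n _
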